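/- Let $A=PSL(2,\mathbb C)=SL(2,\mathbb C)/\{\pm I\}$, regarded as a complex affine algebraic group. For a finitely generated group $G$ with finite generating family $x_1,\dots,x_k$, let $R_A(G)=\mathrm{Hom}(G,A)$ be its representation variety, with the structure of an affine algebraic variety (possibly reducible) coming from the embedding $\rho\mapsto(\rho(x_1),\dots,\rho(x_k))$ onto a Zariski closed subset of $A^k$. For an algebraic variety $V$ of dimension at most $d$, let $N_i(V)$ be the number of irreducible components of $V$ of dimension exactly $i$, and let $P_d(V)=(N_d(V),N_{d-1}(V),\dots,N_0(V))$ be its profile. Theorem 4.5. Let $m,n\ge 2$ be integers, and let $\mathbb Z_m*\mathbb Z_n$ be the free product of the cyclic groups of orders $m$ and $n$. Then, for every choice of the finite generating family, $\dim R_A(\mathbb Z_m*\mathbb Z_n)=4$, and $P_4(R_A(\mathbb Z_m*\mathbb Z_n))$ equals 1. $\left(\frac{mn}{4},\,0,\,\frac{m+n}{2},\,0,\,1\right)$ if $m$ and $n$ are both even; 2. $\left(\frac{n(m-1)}{4},\,0,\,\frac{m+n-1}{2},\,0,\,1\right)$ if $m$ is odd and $n$ is even; 3. $\left(\frac{m(n-1)}{4},\,0,\,\frac{m+n-1}{2},\,0,\,1\right)$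 if $m$ is even and $n$ is odd; 4. $\left(\frac{(m-1)(n-1)}{4},\,0,\,\frac{m+n-2}{2},\,0,\,1\right)$ if $m$ and $n$ are both odd. -/

import Mathlib

open scoped MatrixGroups

noncomputable section

namespace RepProfile

/-! An affine complex algebraic variety (reducible or not) is handled as a set `X` of points with
its coordinate algebra `O`, the algebra of regular functions `X → ℂ`. -/

/-- Pullback of complex-valued functions along a map. -/
def pullback {X Y : Type*} (f : Y → X) : (X → ℂ) →ₐ[ℂ] (Y → ℂ) where
  toFun g := g ∘ f
  map_one' := rfl
  map_mul' _ _ := rfl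
  map_zero' := rfl
  map_add' _ _ := rfl
  commutes' _ := rfl

/-- The common zero set of a set of functions. -/
def zeroSet {X : Type*} (S : Set (X → ℂ)) : Set X := {x | ∀ f ∈ S, f x = 0}

/-- The Zariski topology: the closed sets are exactly the common zero sets of regular functions. -/
@[reducible] def zariskiTopology {X : Type*} (O : Subalgebra ℂ (X → ℂ)) : TopologicalSpace X :=
  TopologicalSpace.ofClosed {V | ∃ S : Set (X → ℂ), S ⊆ O ∧ V = zeroSet S}
    ⟨{1}, by simp [O.one_mem], by ext x; simp [zeroSet]⟩
    (by
      intro A hA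
      refine ⟨{f | f ∈ O ∧ ∀ x ∈ ⋂₀ A, f x = 0}, fun f hf => hf.1, ?_⟩
      ext x
      refine ⟨fun hx f hf => hf.2 x hx, fun hx V hV => ?_⟩
      obtain ⟨S, hS, rfl⟩ := hA hV
      exact fun f hf => hx f ⟨hS hf, fun y hy => hy _ hV f hf⟩)
    (by
      rintro _ ⟨S, hS, rfl⟩ _ ⟨T, hT, rfl⟩
      refine ⟨{h | ∃ f ∈ S, ∃ g ∈ T, h = f * g}, ?_, ?_⟩
      · rintro _ ⟨f, hf, g, hg, rfl⟩
        exact O.mul_mem (hS hf) (hT hg)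
      · ext x
        constructor
        · rintro (hx | hx) _ ⟨f, hf, g, hg, rfl⟩
          · simp [hx f hf]
          · simp [hx g hg]
        · intro hx
          by_contra hcon
          rw [Set.mem_union, not_or] at hcon
          obtain ⟨h1, h2⟩ := hcon
          change ¬ ∀ f ∈ S, f x = 0 at h1
          change ¬ ∀ g ∈ T, g x = 0 at h2
          push Not at h1 h2
          obtain ⟨f, hf, hfx⟩ := h1
          obtain ⟨g, hg, hgx⟩ := h2
          exact mul_ne_zero hfx hgx (hx _ ⟨f, hf, g, hg, rfl⟩))

/-- The coordinate algebra of the (closed) subset `Z`: the restrictions to `Z` of the regular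
functions. -/
def restrict {X : Type*} (O : Subalgebra ℂ (X → ℂ)) (Z : Set X) : Subalgebra ℂ (Z → ℂ) :=
  O.map (pullback (Subtype.val : Z → X))

/-- The dimension of an affine variety: the Krull dimension of its coordinate algebra. -/
def dim {X : Type*} (O : Subalgebra ℂ (X → ℂ)) : WithBot ℕ∞ := ringKrullDim O

/-- The irreducible components, for the Zariski topology. -/
def components {X : Type*} (O : Subalgebra ℂ (X → ℂ)) : Set (Set X) :=
  @irreducibleComponents X (zariskiTopology O)

/-- `N_i`: the number of irreducible components of dimension exactly `i`. -/
def numComponents {X : Type*} (O : Subalgebra ℂ (X → ℂ)) (i : ℕ) : ℕ∞ :=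
  {Z | Z ∈ components O ∧ dim (restrict O Z) = (i : WithBot ℕ∞)}.encard

/-- The profile `P_d = (N_d, N_{d-1}, …, N_0)`. -/
def profile {X : Type*} (O : Subalgebra ℂ (X → ℂ)) (d : ℕ) : Fin (d + 1) → ℕ∞ :=
  fun j => numComponents O (d - (j : ℕ))

/-- The coordinate algebra of `SL(2, ℂ) ^ ι`: the polynomial functions in the matrix entries. -/
def regularSL (ι : Type*) : Subalgebra ℂ ((ι → SL(2, ℂ)) → ℂ) :=
  Algebra.adjoin ℂ (Set.range fun (e : ι × Fin 2 × Fin 2) (s : ι → SL(2, ℂ)) =>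
    (s e.1 : Matrix (Fin 2) (Fin 2) ℂ) e.2.1 e.2.2)

/-- The coordinate algebra of `PSL(2, ℂ) ^ ι`, the quotient of `SL(2, ℂ) ^ ι` by the finite group
`{±1} ^ ι`: a function is regular when its pullback to `SL(2, ℂ) ^ ι` is. -/
def regularPSL (ι : Type*) : Subalgebra ℂ ((ι → PSL(2, ℂ)) → ℂ) :=
  (regularSL ι).comap (pullback fun (s : ι → SL(2, ℂ)) (i : ι) => (s i : PSL(2, ℂ)))

/-- The coordinate algebra of the representation variety `Hom(G, PSL(2, ℂ))`, when `x` is a finite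
generating family of `G`: the variety structure comes from the embedding
`ρ ↦ (ρ (x i))_i` of `Hom(G, PSL(2, ℂ))` onto a closed subset of `PSL(2, ℂ) ^ ι`. -/
def regularRep {G : Type*} [Group G] {ι : Type*} (x : ι → G) :
    Subalgebra ℂ ((G →* PSL(2, ℂ)) → ℂ) :=
  (regularPSL ι).map (pullback fun (ρ : G →* PSL(2, ℂ)) (i : ι) => ρ (x i))

end RepProfile

end

/-! A representation of a free product of finite cyclic groups is a choice of elements of
`PSL(2, ℂ)` whose orders divide the given ones. An element of finite order is semisimple, so its
conjugacy class is determined by the square of its trace, and the classes of order dividing `N` are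
those of rotations by the angles `π k / N` with `0 ≤ k ≤ N / 2`. Hence the representation variety is
a disjoint union of products of conjugacy classes. These products are closed, as level sets of
squared traces, and irreducible, as images of affine spaces, so they are the components. A
nontrivial class is finite over the plane, so contributes `2` to the dimension; therefore the
components of dimension `2 j` correspond to the choices of `j` factors and of a nontrivial class in
each of them. -/

noncomputable section

namespace RepProfile

open Topology

section KrullDim

variable {R S : Type*} [CommRing R] [CommRing S] [Algebra R S] [Algebra.IsIntegral R S]

variable (R S) in
lemma ringKrullDim_le_of_isIntegral : ringKrullDim S ≤ ringKrullDim R :=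
  Order.krullDim_le_of_strictMono (PrimeSpectrum.comap (algebraMap R S)) fun _ _ h =>
    Ideal.IsIntegral.comap_lt_comap (R := R) h

variable [FaithfulSMul R S]

lemma exists_ltSeries_comap_last_eq (l : LTSeries (PrimeSpectrum R)) :
    ∃ L : LTSeries (PrimeSpectrum S), L.length = l.length ∧
      PrimeSpectrum.comap (algebraMap R S) L.last = l.last := by
  induction l using RelSeries.inductionOn' with
  | singleton p =>
    obtain ⟨Q, hQ, hQp⟩ := Ideal.nonempty_primesOver (S := S) p.asIdeal
    exact ⟨RelSeries.singleton _ ⟨Q, hQ⟩, rfl, PrimeSpectrum.ext hQp.over.symm⟩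
  | snoc l p hlp ih =>
    replace hlp : l.last < p := hlp
    obtain ⟨L, hL, hlast⟩ := ih
    obtain ⟨Q, hLQ, hQ, hQp⟩ := Ideal.exists_ideal_over_prime_of_isIntegral_of_isPrime p.asIdeal
      L.last.asIdeal ((congrArg PrimeSpectrum.asIdeal hlast).trans_le hlp.le)
    have hcomap : PrimeSpectrum.comap (algebraMap R S) ⟨Q, hQ⟩ = p := PrimeSpectrum.ext hQp
    have hlt : L.last < ⟨Q, hQ⟩ := by
      refine lt_of_le_of_ne hLQ fun h => hlp.ne ?_
      rw [← hcomap, ← hlast, h]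
    exact ⟨L.snoc ⟨Q, hQ⟩ hlt, by simp [hL], by simpa using hcomap⟩

variable (R S) in
lemma ringKrullDim_eq_of_isIntegral : ringKrullDim S = ringKrullDim R := by
  refine (ringKrullDim_le_of_isIntegral R S).antisymm (iSup_le fun l => ?_)
  obtain ⟨L, hL, -⟩ := exists_ltSeries_comap_last_eq (S := S) l
  rw [← hL]
  exact le_iSup (fun L : LTSeries (PrimeSpectrum S) => ((L.length : ℕ) : WithBot ℕ∞)) L

end KrullDim

section Variety

variable {X Y : Type*} {O : Subalgebra ℂ (X → ℂ)}

lemma algebraicIndependent_of_forall_exists_apply_eq {σ : Type*} {u : σ → X → ℂ}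
    (hu : ∀ z : σ → ℂ, ∃ x, ∀ j, u j x = z j) : AlgebraicIndependent ℂ u := by
  rw [algebraicIndependent_iff]
  refine fun p hp => MvPolynomial.funext fun z => ?_
  obtain ⟨x, hx⟩ := hu z
  have heval : Pi.evalAlgHom ℂ (fun _ : X => ℂ) x (MvPolynomial.aeval u p) =
      MvPolynomial.eval z p := by
    rw [MvPolynomial.comp_aeval_apply, ← MvPolynomial.aeval_eq_eval]
    simp [hx]
  rw [← heval, hp, map_zero, map_zero]

lemma dim_eq_natCard_of_isIntegral {σ : Type*} [Finite σ] {u : σ → X → ℂ} (huO : ∀ j, u j ∈ O)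
    (hu : ∀ z : σ → ℂ, ∃ x, ∀ j, u j x = z j)
    (hO : ∀ f ∈ O, IsIntegral (Algebra.adjoin ℂ (Set.range u)) f) :
    dim O = (Nat.card σ : WithBot ℕ∞) := by
  let A := Algebra.adjoin ℂ (Set.range u)
  have hAO : A ≤ O := Algebra.adjoin_le (Set.range_subset_iff.2 huO)
  let : Algebra A O := (Subalgebra.inclusion hAO).toRingHom.toAlgebra
  let val : O →ₐ[A] (X → ℂ) := { O.val.toRingHom with commutes' := fun _ => rfl }
  have : Algebra.IsIntegral A O :=
    ⟨fun f => (isIntegral_algHom_iff val Subtype.val_injective).1 (hO f f.2)⟩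
  have : FaithfulSMul A O :=
    (faithfulSMul_iff_algebraMap_injective A O).2 (Subalgebra.inclusion_injective hAO)
  calc ringKrullDim O = ringKrullDim A := ringKrullDim_eq_of_isIntegral A O
    _ = ringKrullDim (MvPolynomial σ ℂ) :=
      (ringKrullDim_eq_of_ringEquiv
        (algebraicIndependent_of_forall_exists_apply_eq hu).aevalEquiv.toRingEquiv).symm
    _ = (Nat.card σ : WithBot ℕ∞) := by
      rw [MvPolynomial.ringKrullDim_of_isNoetherianRing, ringKrullDim_eq_zero_of_field, zero_add]

variable (O) in
lemma dim_restrict_univ : dim (restrict O Set.univ) = dim O :=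
  (ringKrullDim_eq_of_ringEquiv (O.equivMapOfInjective _
    (Function.Surjective.injective_comp_right fun x => ⟨⟨x, trivial⟩, rfl⟩)).toRingEquiv).symm

lemma isClosed_zariskiTopology_iff {V : Set X} :
    IsClosed[zariskiTopology O] V ↔ ∃ S : Set (X → ℂ), S ⊆ O ∧ V = zeroSet S := by
  rw [← @isOpen_compl_iff X V (zariskiTopology O)]
  change Vᶜᶜ ∈ _ ↔ _
  rw [compl_compl]
  rfl

lemma isIrreducible_range_of_noZeroDivisors [Nonempty Y] {P : Subalgebra ℂ (Y → ℂ)}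
    [NoZeroDivisors P] {F : Y → X} (hF : ∀ f ∈ O, f ∘ F ∈ P) :
    @IsIrreducible X (zariskiTopology O) (Set.range F) := by
  let := zariskiTopology O
  refine ⟨Set.range_nonempty F, isPreirreducible_iff_isClosed_union_isClosed.2 ?_⟩
  intro V W hV hW hVW
  obtain ⟨S, hS, rfl⟩ := isClosed_zariskiTopology_iff.1 hV
  obtain ⟨T, hT, rfl⟩ := isClosed_zariskiTopology_iff.1 hW
  by_contra! hcon
  simp only [Set.range_subset_iff, not_forall, zeroSet, Set.mem_ofPred_eq] at hcon
  obtain ⟨⟨y, f, hf, hfy⟩, z, g, hg, hgz⟩ := hcon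
  have hfg : (⟨f ∘ F, hF f (hS hf)⟩ : P) * ⟨g ∘ F, hF g (hT hg)⟩ = 0 := by
    refine Subtype.ext (funext fun w => ?_)
    rcases hVW ⟨w, rfl⟩ with h | h
    · simp [h f hf]
    · simp [h g hg]
  rcases mul_eq_zero.1 hfg with h | h
  · exact hfy (congrFun (congrArg Subtype.val h) y)
  · exact hgz (congrFun (congrArg Subtype.val h) z)

section Components

variable {I : Type*} [Finite I] {Z : I → Set X}

lemma irreducibleComponents_eq_range [TopologicalSpace X] (hclosed : ∀ i, IsClosed (Z i))
    (hirr : ∀ i, IsIrreducible (Z i)) (hcover : ⋃ i, Z i = Set.univ)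
    (hdisj : Pairwise (Function.onFun Disjoint Z)) :
    irreducibleComponents X = Set.range Z := by
  have exists_subset : ∀ T : Set X, IsIrreducible T → ∃ i, T ⊆ Z i := by
    intro T hT
    obtain ⟨V, hV, hTV⟩ := isIrreducible_iff_sUnion_isClosed.1 hT (Set.finite_range Z).toFinset
      (by simpa using hclosed) (by simp [hcover])
    obtain ⟨i, rfl⟩ := (Set.Finite.mem_toFinset _).1 hV
    exact ⟨i, hTV⟩
  have maximal (i : I) : Maximal IsIrreducible (Z i) := by
    refine ⟨hirr i, fun T hT hle => ?_⟩
    obtain ⟨j, hj⟩ := exists_subset T hT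
    obtain ⟨x, hx⟩ := (hirr i).nonempty
    obtain rfl : i = j := by
      by_contra hij
      exact Set.disjoint_left.1 (hdisj hij) hx (hj (hle hx))
    exact hj
  ext T
  refine ⟨fun hT => ?_, ?_⟩
  · obtain ⟨i, hi⟩ := exists_subset T hT.prop
    exact ⟨i, (hT.eq_of_le (hirr i) hi).symm⟩
  · rintro ⟨i, rfl⟩
    exact maximal i

lemma numComponents_eq_encard {δ : I → ℕ} (hclosed : ∀ i, IsClosed[zariskiTopology O] (Z i))
    (hirr : ∀ i, @IsIrreducible X (zariskiTopology O) (Z i)) (hcover : ⋃ i, Z i = Set.univ)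
    (hdisj : Pairwise (Function.onFun Disjoint Z))
    (hdim : ∀ i, dim (restrict O (Z i)) = (δ i : WithBot ℕ∞)) (d : ℕ) :
    numComponents O d = {i | δ i = d}.encard := by
  let := zariskiTopology O
  have hinj : Function.Injective Z := fun i j hij => by
    by_contra hne
    obtain ⟨x, hx⟩ := (hirr i).nonempty
    exact Set.disjoint_left.1 (hdisj hne) hx (hij ▸ hx)
  rw [numComponents, components, irreducibleComponents_eq_range hclosed hirr hcover hdisj,
    ← hinj.encard_image]
  congr 1
  ext T
  constructor
  · rintro ⟨⟨i, rfl⟩, hi⟩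
    exact ⟨i, by exact_mod_cast (hdim i).symm.trans hi, rfl⟩
  · rintro ⟨i, rfl, rfl⟩
    exact ⟨⟨i, rfl⟩, hdim i⟩

end Components

lemma isIntegral_of_mem {A : Subalgebra ℂ (Y → ℂ)} {f : Y → ℂ} (hf : f ∈ A) : IsIntegral A f :=
  isIntegral_algebraMap (x := (⟨f, hf⟩ : A))

lemma isIntegral_of_finite_range (A : Subalgebra ℂ (Y → ℂ)) {f : Y → ℂ}
    (hf : (Set.range f).Finite) : IsIntegral A f := by
  refine ⟨∏ c ∈ hf.toFinset, (Polynomial.X - Polynomial.C (algebraMap ℂ A c)),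
    Polynomial.monic_prod_of_monic _ _ fun c _ => Polynomial.monic_X_sub_C _, ?_⟩
  rw [Polynomial.eval₂_finsetProd]
  funext y
  rw [Finset.prod_apply]
  refine Finset.prod_eq_zero (hf.mem_toFinset.2 ⟨y, rfl⟩) ?_
  simp only [Polynomial.eval₂_sub, Polynomial.eval₂_X, Polynomial.eval₂_C]
  exact sub_self _

end Variety

section RegularFunctions

variable {Y : Type*} {P : Subalgebra ℂ (Y → ℂ)}

/-- The families of matrices in `SL(2, ℂ)`, indexed by `Y`, whose entries, as functions on `Y`,
belong to `P`; this is the group `SL(2, P)`. -/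
def entrySubgroup (P : Subalgebra ℂ (Y → ℂ)) : Subgroup (Y → SL(2, ℂ)) where
  carrier := {g | ∀ a b, (fun y => g y a b) ∈ P}
  one_mem' a b := P.algebraMap_mem ((1 : Matrix (Fin 2) (Fin 2) ℂ) a b)
  mul_mem' {g h} hg hh a b := by
    convert P.sum_mem fun c (_ : c ∈ Finset.univ) => P.mul_mem (hg a c) (hh c b) using 1
    ext y
    simp [Matrix.mul_apply]
  inv_mem' {g} hg a b := by
    simp only [Pi.inv_apply, Matrix.SpecialLinearGroup.SL2_inv_expl]
    fin_cases a <;> fin_cases b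
    exacts [hg 1 1, P.neg_mem (hg 0 1), P.neg_mem (hg 1 0), hg 0 0]

lemma const_mem_entrySubgroup (A : SL(2, ℂ)) : (fun _ => A) ∈ entrySubgroup P :=
  fun a b => P.algebraMap_mem (A a b)

lemma transvection_mem_entrySubgroup {i j : Fin 2} (hij : i ≠ j) {c : Y → ℂ} (hc : c ∈ P) :
    (fun y => Matrix.SpecialLinearGroup.transvection hij (c y)) ∈ entrySubgroup P := by
  intro a b
  refine P.add_mem (P.algebraMap_mem ((1 : Matrix (Fin 2) (Fin 2) ℂ) a b)) ?_
  by_cases h : i = a ∧ j = b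
  · simpa [Matrix.single_apply, h] using hc
  · simp only [Matrix.single_apply, h, if_false]
    exact P.zero_mem

variable {ι κ : Type*}

lemma comp_mem_of_mem_entrySubgroup {g : Y → ι → SL(2, ℂ)}
    (hg : ∀ i, (fun y => g y i) ∈ entrySubgroup P) {f : (ι → SL(2, ℂ)) → ℂ}
    (hf : f ∈ regularSL ι) : f ∘ g ∈ P := by
  have hle : regularSL ι ≤ P.comap (pullback g) := by
    refine Algebra.adjoin_le ?_
    rintro _ ⟨⟨i, a, b⟩, rfl⟩
    exact hg i a b
  exact hle hf

lemma apply_mem_entrySubgroup_regularSL (i : ι) :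
    (fun s : ι → SL(2, ℂ) => s i) ∈ entrySubgroup (regularSL ι) :=
  fun a b => Algebra.subset_adjoin ⟨(i, a, b), rfl⟩

lemma map_freeGroup_lift {H K : Type*} [Group H] [Group K] (φ : H →* K) (a : ι → H)
    (w : FreeGroup ι) : φ (FreeGroup.lift a w) = FreeGroup.lift (fun i => φ (a i)) w :=
  FreeGroup.lift_unique (φ.comp (FreeGroup.lift a)) (by simp)

lemma freeGroupLift_mem_entrySubgroup_regularSL (w : FreeGroup ι) :
    (fun s : ι → SL(2, ℂ) => FreeGroup.lift s w) ∈ entrySubgroup (regularSL ι) := by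
  have hrange : (FreeGroup.lift fun i (s : ι → SL(2, ℂ)) => s i).range ≤
      entrySubgroup (regularSL ι) :=
    FreeGroup.range_lift_le (Set.range_subset_iff.2 apply_mem_entrySubgroup_regularSL)
  convert hrange ⟨w, rfl⟩ with s
  exact (map_freeGroup_lift (Pi.evalMonoidHom (fun _ => SL(2, ℂ)) s) (fun i t => t i) w).symm

variable {G : Type*} [Group G]

lemma regularRep_le_of_mem_closure {x : ι → G} {y : κ → G}
    (hy : ∀ j, y j ∈ Subgroup.closure (Set.range x)) : regularRep y ≤ regularRep x := by
  rw [← FreeGroup.range_lift_eq_closure] at hy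
  choose w hw using hy
  rintro _ ⟨f, hf, rfl⟩
  refine ⟨fun A => f fun j => FreeGroup.lift A (w j), ?_, funext fun ρ => ?_⟩
  · have hmem := comp_mem_of_mem_entrySubgroup
      (g := fun (s : ι → SL(2, ℂ)) j => FreeGroup.lift s (w j))
      (fun j => freeGroupLift_mem_entrySubgroup_regularSL (w j)) hf
    change pullback _ _ ∈ regularSL ι
    refine Set.mem_of_eq_of_mem (funext fun s => congrArg f (funext fun j => ?_)) hmem
    exact (map_freeGroup_lift (QuotientGroup.mk' _) s (w j)).symm
  · refine congrArg f (funext fun j => ?_)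
    exact (map_freeGroup_lift ρ x (w j)).symm.trans (congrArg ρ (hw j))

lemma regularRep_eq_of_closure_eq_top {x : ι → G} {y : κ → G}
    (hx : Subgroup.closure (Set.range x) = ⊤) (hy : Subgroup.closure (Set.range y) = ⊤) :
    regularRep x = regularRep y :=
  le_antisymm (regularRep_le_of_mem_closure fun j => hy ▸ Subgroup.mem_top (x j))
    (regularRep_le_of_mem_closure fun j => hx ▸ Subgroup.mem_top (y j))

lemma comp_mem_of_mem_regularRep {x : ι → G} {F : Y → G →* PSL(2, ℂ)} {g : Y → ι → SL(2, ℂ)}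
    (hg : ∀ i, (fun y => g y i) ∈ entrySubgroup P) (hF : ∀ y i, F y (x i) = (g y i : PSL(2, ℂ)))
    {f : (G →* PSL(2, ℂ)) → ℂ} (hf : f ∈ regularRep x) : f ∘ F ∈ P := by
  obtain ⟨f, hf, rfl⟩ := hf
  convert! comp_mem_of_mem_entrySubgroup hg hf using 1
  ext y
  exact congrArg f (funext fun i => hF y i)

lemma apply_mem_regularRep (x : ι → G) (i : ι) {h : PSL(2, ℂ) → ℂ}
    (hh : (fun s : ι → SL(2, ℂ) => h (s i)) ∈ regularSL ι) :
    (fun ρ : G →* PSL(2, ℂ) => h (ρ (x i))) ∈ regularRep x :=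
  ⟨fun A => h (A i), hh, rfl⟩

end RegularFunctions

section Coordinates

lemma coe_eq_coe_iff {A B : SL(2, ℂ)} : (A : PSL(2, ℂ)) = B ↔ A = B ∨ A = -B := by
  rw [QuotientGroup.eq, Matrix.SpecialLinearGroup.mem_center_iff]
  constructor
  · rintro ⟨r, hr, h⟩
    have hB : (B : Matrix (Fin 2) (Fin 2) ℂ) = A * Matrix.scalar (Fin 2) r := by
      rw [h, ← Matrix.SpecialLinearGroup.coe_mul, mul_inv_cancel_left]
    obtain rfl | rfl : r = 1 ∨ r = -1 := by simpa using hr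
    · exact .inl (Subtype.ext (by simpa using hB.symm))
    · exact .inr (neg_eq_iff_eq_neg.1 (Subtype.ext (by ext a b; simp [hB])))
  · rintro (rfl | rfl)
    · exact ⟨1, by simp⟩
    · exact ⟨-1, by simp, by ext a b; fin_cases a <;> fin_cases b <;> simp⟩

lemma coe_neg (A : SL(2, ℂ)) : ((-A : SL(2, ℂ)) : PSL(2, ℂ)) = A :=
  coe_eq_coe_iff.2 (.inr rfl)

lemma out_coe_eq_or (A : SL(2, ℂ)) :
    Quotient.out (A : PSL(2, ℂ)) = A ∨ Quotient.out (A : PSL(2, ℂ)) = -A :=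
  coe_eq_coe_iff.1 (Quotient.out_eq (A : PSL(2, ℂ)))

/-- The square of the trace, a regular function on `PSL(2, ℂ)`. -/
def sqTrace (A : PSL(2, ℂ)) : ℂ := (Quotient.out A).1.trace ^ 2

/-- The square of the upper left entry, a regular function on `PSL(2, ℂ)`. -/
def sqDiag (A : PSL(2, ℂ)) : ℂ := (Quotient.out A).1 0 0 ^ 2

/-- The square of the sum of the off-diagonal entries, a regular function on `PSL(2, ℂ)`. -/
def sqOffDiag (A : PSL(2, ℂ)) : ℂ := ((Quotient.out A).1 0 1 + (Quotient.out A).1 1 0) ^ 2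

variable (A : SL(2, ℂ))

lemma sqTrace_coe : sqTrace (A : PSL(2, ℂ)) = A.1.trace ^ 2 := by
  rcases out_coe_eq_or A with h | h <;> simp [sqTrace, h]

lemma sqDiag_coe : sqDiag (A : PSL(2, ℂ)) = A 0 0 ^ 2 := by
  rcases out_coe_eq_or A with h | h <;> simp [sqDiag, h]

lemma sqOffDiag_coe : sqOffDiag (A : PSL(2, ℂ)) = (A 0 1 + A 1 0) ^ 2 := by
  rcases out_coe_eq_or A with h | h
  · rw [sqOffDiag, h]
  · simp only [sqOffDiag, h, Matrix.SpecialLinearGroup.coe_neg, Matrix.neg_apply]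
    ring

variable {G ι : Type*} [Group G] (x : ι → G) (i : ι)

lemma sqTrace_mem_regularRep : (fun ρ : G →* PSL(2, ℂ) => sqTrace (ρ (x i))) ∈ regularRep x := by
  refine apply_mem_regularRep x i ?_
  simp only [sqTrace_coe, Matrix.trace_fin_two]
  have h := apply_mem_entrySubgroup_regularSL i
  exact Subalgebra.pow_mem _ (Subalgebra.add_mem _ (h 0 0) (h 1 1)) 2

lemma sqDiag_mem_regularRep : (fun ρ : G →* PSL(2, ℂ) => sqDiag (ρ (x i))) ∈ regularRep x := by
  refine apply_mem_regularRep x i ?_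
  simp only [sqDiag_coe]
  exact Subalgebra.pow_mem _ (apply_mem_entrySubgroup_regularSL i 0 0) 2

lemma sqOffDiag_mem_regularRep :
    (fun ρ : G →* PSL(2, ℂ) => sqOffDiag (ρ (x i))) ∈ regularRep x := by
  refine apply_mem_regularRep x i ?_
  simp only [sqOffDiag_coe]
  have h := apply_mem_entrySubgroup_regularSL i
  exact Subalgebra.pow_mem _ (Subalgebra.add_mem _ (h 0 1) (h 1 0)) 2

lemma mem_entrySubgroup_integralClosure {Y : Type*} {R : Subalgebra ℂ (Y → ℂ)} {g : Y → SL(2, ℂ)}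
    (htrace : IsIntegral R fun y => sqTrace (g y)) (hdiag : IsIntegral R fun y => sqDiag (g y))
    (hoffDiag : IsIntegral R fun y => sqOffDiag (g y)) :
    g ∈ entrySubgroup ((integralClosure R (Y → ℂ)).restrictScalars ℂ) := by
  simp only [sqTrace_coe, sqDiag_coe, sqOffDiag_coe, Matrix.trace_fin_two]
    at htrace hdiag hoffDiag
  let B := (integralClosure R (Y → ℂ)).restrictScalars ℂ
  let e (a b : Fin 2) (y : Y) : ℂ := g y a b
  have h00 : e 0 0 ∈ B := IsIntegral.of_pow two_pos hdiag
  have h11 : e 1 1 ∈ B := by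
    have htr : e 0 0 + e 1 1 ∈ B := IsIntegral.of_pow two_pos htrace
    simpa using B.sub_mem htr h00
  have hadd : e 0 1 + e 1 0 ∈ B := IsIntegral.of_pow two_pos hoffDiag
  have hsub : e 0 1 - e 1 0 ∈ B := by
    have hsq : (e 0 1 - e 1 0) ^ 2 = (e 0 1 + e 1 0) ^ 2 - (4 : ℂ) • (e 0 0 * e 1 1 - 1) := by
      funext y
      have hdet := (g y).det_coe
      rw [Matrix.det_fin_two] at hdet
      simp only [e, Pi.pow_apply, Pi.sub_apply, Pi.add_apply, Pi.smul_apply, Pi.mul_apply,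
        Pi.one_apply, smul_eq_mul]
      linear_combination 4 * hdet
    refine IsIntegral.of_pow two_pos (?_ : (e 0 1 - e 1 0) ^ 2 ∈ B)
    rw [hsq]
    exact B.sub_mem (B.pow_mem hadd 2) (B.smul_mem (B.sub_mem (B.mul_mem h00 h11) B.one_mem) 4)
  have h01 : e 0 1 ∈ B := by
    convert! B.smul_mem (B.add_mem hadd hsub) (1 / 2 : ℂ) using 1
    module
  have h10 : e 1 0 ∈ B := by
    convert! B.smul_mem (B.sub_mem hadd hsub) (1 / 2 : ℂ) using 1
    module
  intro a b
  fin_cases a <;> fin_cases b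
  exacts [h00, h01, h10, h11]

end Coordinates

section Conjugacy

open Matrix.SpecialLinearGroup

/-- The diagonal matrix with eigenvalues `exp (± i θ)`. -/
def torus (θ : ℂ) : SL(2, ℂ) := diag2 (Complex.exp (θ * Complex.I)) (Complex.exp_ne_zero _)

lemma torus_coe (θ : ℂ) : (torus θ : Matrix (Fin 2) (Fin 2) ℂ) =
    !![Complex.exp (θ * Complex.I), 0; 0, Complex.exp (-θ * Complex.I)] := by
  rw [torus, diag2_coe', ← Complex.exp_neg, neg_mul]

lemma torus_add (θ φ : ℂ) : torus (θ + φ) = torus θ * torus φ := by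
  ext a b
  simp only [coe_mul, torus_coe, neg_add, add_mul, Complex.exp_add]
  fin_cases a <;> fin_cases b <;> simp

lemma torus_pow (θ : ℂ) (N : ℕ) : torus θ ^ N = torus (N * θ) := by
  induction N with
  | zero => ext a b; fin_cases a <;> fin_cases b <;> simp [torus_coe]
  | succ N ih => rw [pow_succ, ih, ← torus_add, Nat.cast_succ, add_one_mul]

lemma trace_torus (θ : ℂ) : (torus θ).1.trace = 2 * Complex.cos θ := by
  rw [torus_coe, Matrix.trace_fin_two_of, Complex.two_cos]

lemma coe_torus_eq_one {θ : ℂ} (hθ : Complex.sin θ = 0) : (torus θ : PSL(2, ℂ)) = 1 := by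
  have hexp : Complex.exp (θ * Complex.I) = Complex.cos θ := by simp [Complex.exp_mul_I, hθ]
  have hexp_neg : Complex.exp (-θ * Complex.I) = Complex.cos θ := by
    simp [Complex.exp_mul_I, hθ, -neg_mul]
  refine coe_eq_coe_iff.2
    ((Complex.sin_eq_zero_iff_cos_eq.1 hθ).imp (fun hcos => ?_) fun hcos => ?_)
  all_goals
    ext a b
    rw [torus_coe, hexp, hexp_neg, hcos]
    fin_cases a <;> fin_cases b <;> simp

/-- A product of three unipotent matrices; its values cover an open subset of
`SL(2, ℂ) / torus`, and a little more. -/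
def unipotentProd (v : Fin 3 → ℂ) : SL(2, ℂ) :=
  transvection one_ne_zero (v 0) * transvection zero_ne_one (v 1) * transvection one_ne_zero (v 2)

lemma unipotentProd_coe (p q r : ℂ) : (unipotentProd ![p, q, r] : Matrix (Fin 2) (Fin 2) ℂ) =
    !![1 + q * r, q; p + r + p * q * r, 1 + p * q] := by
  ext a b
  fin_cases a <;> fin_cases b <;>
    simp [unipotentProd, transvection_coe, Matrix.mul_apply, Matrix.single_apply] <;> ring

/-- A polynomial parametrisation of the conjugacy class of `torus θ`, if `sin θ ≠ 0`. -/
def conjParam (θ : ℂ) (v : Fin 3 → ℂ) : SL(2, ℂ) :=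
  unipotentProd v * torus θ * (unipotentProd v)⁻¹

lemma conjParam_mem_entrySubgroup {Y : Type*} {P : Subalgebra ℂ (Y → ℂ)} {v : Y → Fin 3 → ℂ}
    (hv : ∀ j, (fun y => v y j) ∈ P) (θ : ℂ) :
    (fun y => conjParam θ (v y)) ∈ entrySubgroup P := by
  have hprod : (fun y => unipotentProd (v y)) ∈ entrySubgroup P :=
    mul_mem (mul_mem (transvection_mem_entrySubgroup _ (hv 0))
      (transvection_mem_entrySubgroup _ (hv 1))) (transvection_mem_entrySubgroup _ (hv 2))
  exact mul_mem (mul_mem hprod (const_mem_entrySubgroup _)) (inv_mem hprod)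

lemma conjParam_pow (θ : ℂ) (v : Fin 3 → ℂ) (N : ℕ) :
    conjParam θ v ^ N = conjParam (N * θ) v := by
  rw [conjParam, conj_pow, torus_pow, conjParam]

lemma trace_conjParam (θ : ℂ) (v : Fin 3 → ℂ) :
    (conjParam θ v).1.trace = 2 * Complex.cos θ := by
  rw [← trace_torus θ, conjParam, coe_mul, coe_mul, Matrix.trace_mul_comm, ← Matrix.mul_assoc,
    ← coe_mul, inv_mul_cancel, coe_one, Matrix.one_mul]

lemma coe_conjParam_eq_one {θ : ℂ} (hθ : Complex.sin θ = 0) (v : Fin 3 → ℂ) :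
    (conjParam θ v : PSL(2, ℂ)) = 1 := by
  rw [conjParam, QuotientGroup.mk_mul, QuotientGroup.mk_mul, coe_torus_eq_one hθ, mul_one,
    ← QuotientGroup.mk_mul, mul_inv_cancel, QuotientGroup.mk_one]

lemma exists_mul_unipotentProd_eq {A : SL(2, ℂ)} {z w : ℂ} (hzw : z * w = 1) (hne : z ≠ w)
    (htrace : A.1.trace = z + w) :
    ∃ v, A.1 * (unipotentProd v).1 = (unipotentProd v).1 * !![z, 0; 0, w] := by
  have hdet := A.det_coe
  rw [Matrix.det_fin_two] at hdet
  rw [Matrix.trace_fin_two] at htrace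
  have hsub : z - w ≠ 0 := sub_ne_zero.2 hne
  have hsub' : w - z ≠ 0 := sub_ne_zero.2 hne.symm
  generalize ha : A.1 0 0 = a, hb : A.1 0 1 = b, hc : A.1 1 0 = c, hd : A.1 1 1 = d at *
  -- The columns of `unipotentProd v` have to be eigenvectors of `A` for `z` and `w`.
  suffices ∃ p q r : ℂ,
      a * (1 + q * r) + b * (p + r + p * q * r) = (1 + q * r) * z ∧
      a * q + b * (1 + p * q) = q * w ∧
      c * (1 + q * r) + d * (p + r + p * q * r) = (p + r + p * q * r) * z ∧
      c * q + d * (1 + p * q) = (1 + p * q) * w by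
    obtain ⟨p, q, r, h₀₀, h₀₁, h₁₀, h₁₁⟩ := this
    refine ⟨![p, q, r], ?_⟩
    rw [unipotentProd_coe, Matrix.eta_fin_two A.1, ha, hb, hc, hd]
    ext i j
    fin_cases i <;> fin_cases j <;> simp [h₀₀, h₀₁, h₁₀, h₁₁]
  obtain rfl : d = z + w - a := by linear_combination htrace
  by_cases hb₀ : b = 0
  · subst hb₀
    have hroot : (a - z) * (a - w) = 0 := by linear_combination hzw - hdet
    rcases mul_eq_zero.1 hroot with h | h
    · obtain rfl := sub_eq_zero.1 h
      refine ⟨c / (a - w), 0, 0, ?_, ?_, ?_, ?_⟩ <;> field_simp <;> ring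
    · obtain rfl := sub_eq_zero.1 h
      refine ⟨1 - c / (z - a), -1, 1, ?_, ?_, ?_, ?_⟩ <;> field_simp <;> ring
  · obtain rfl : c = (z - a) * (a - w) / b := by
      field_simp
      linear_combination hzw - hdet
    refine ⟨(z - a) / b, b / (w - z), 0, ?_, ?_, ?_, ?_⟩ <;> field_simp <;> ring

lemma exists_conjParam_eq {A : SL(2, ℂ)} {θ : ℂ} (hθ : Complex.sin θ ≠ 0)
    (htrace : A.1.trace = 2 * Complex.cos θ) : ∃ v, conjParam θ v = A := by
  rw [Complex.two_cos] at htrace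
  have hne : Complex.exp (θ * Complex.I) ≠ Complex.exp (-θ * Complex.I) := fun h =>
    hθ (by simpa [h] using Complex.two_sin θ)
  obtain ⟨v, hv⟩ := exists_mul_unipotentProd_eq (by simp [← Complex.exp_add]) hne htrace
  rw [← torus_coe] at hv
  have hmul : A * unipotentProd v = unipotentProd v * torus θ := Subtype.ext hv
  exact ⟨v, (eq_mul_inv_iff_mul_eq.2 hmul).symm⟩

lemma exists_trace_eq_and_sqDiag_eq_and_sqOffDiag_eq (t α β : ℂ) :
    ∃ A : SL(2, ℂ), A.1.trace = t ∧ sqDiag A = α ∧ sqOffDiag A = β := by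
  obtain ⟨a, ha⟩ := IsAlgClosed.exists_pow_nat_eq α two_pos
  obtain ⟨u, hu⟩ := IsAlgClosed.exists_pow_nat_eq β two_pos
  obtain ⟨v, hv⟩ := IsAlgClosed.exists_pow_nat_eq (u ^ 2 - 4 * (a * (t - a) - 1)) two_pos
  refine ⟨⟨!![a, (u + v) / 2; (u - v) / 2, t - a], ?_⟩, ?_, ?_, ?_⟩
  · rw [Matrix.det_fin_two_of]
    linear_combination hv / 4
  · simp [Matrix.trace_fin_two_of]
  · exact (sqDiag_coe _).trans ha
  · refine (sqOffDiag_coe _).trans (Eq.trans (congrArg (· ^ 2) ?_) hu)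
    change (u + v) / 2 + (u - v) / 2 = u
    ring

lemma coe_eq_one_of_pow_eq_one {A : SL(2, ℂ)} {N : ℕ} (hN : N ≠ 0) (htrace : A.1.trace = 2)
    (hpow : (A : PSL(2, ℂ)) ^ N = 1) : A = 1 := by
  have hsq : A.1 * (A.1 - 1) = A.1 - 1 := by
    have hcharpoly := A.1.aeval_self_charpoly
    rw [Matrix.charpoly_fin_two, htrace, A.det_coe] at hcharpoly
    simp only [map_one, map_add, Polynomial.aeval_sub, map_pow, Polynomial.aeval_X, map_mul,
      Polynomial.aeval_C, Algebra.algebraMap_eq_smul_one, two_smul] at hcharpoly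
    rw [← sub_eq_zero, ← hcharpoly]
    noncomm_ring
  have hAN : A.1 ^ N = 1 + (N : ℂ) • (A.1 - 1) := by
    clear hN hpow
    induction N with
    | zero => simp
    | succ n ih =>
      rw [pow_succ', ih, mul_add, mul_one, mul_smul_comm, hsq, Nat.cast_succ]
      module
  have hneg : A ^ N ≠ -1 := fun h => by
    have htraceN := congrArg Matrix.trace hAN
    rw [← coe_pow, h] at htraceN
    norm_num [htrace] at htraceN
  rw [← QuotientGroup.mk_pow, ← QuotientGroup.mk_one, coe_eq_coe_iff, or_iff_left hneg] at hpow
  rw [← coe_pow, hpow, coe_one, left_eq_add, smul_eq_zero_iff_right (Nat.cast_ne_zero.2 hN),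
    sub_eq_zero] at hAN
  exact Subtype.ext hAN

end Conjugacy

section Torsion

open scoped Real

/-- The angle `π k / N`, for which the `N`-th power of `torus` is trivial in `PSL(2, ℂ)`. -/
def torsionAngle (N k : ℕ) : ℝ := π * k / N

/-- A conjugacy class of elements of order dividing `N` in `PSL(2, ℂ)`, the one of
`torus (torsionAngle N k)`; the trace determines it because an element of finite order is
semisimple. -/
def torsionClass (N k : ℕ) : Set PSL(2, ℂ) :=
  {A | A ^ N = 1 ∧ sqTrace A = (2 * Complex.cos (torsionAngle N k)) ^ 2}

variable {N k l : ℕ}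

lemma torsionAngle_mem_Icc (hk : k ≤ N / 2) : torsionAngle N k ∈ Set.Icc 0 (π / 2) := by
  refine ⟨by rw [torsionAngle]; positivity, ?_⟩
  rcases N.eq_zero_or_pos with rfl | hN
  · simpa [torsionAngle] using Real.pi_div_two_pos.le
  have h2k : (k : ℝ) * 2 ≤ N := by exact_mod_cast (Nat.le_div_iff_mul_le two_pos).1 hk
  rw [torsionAngle, div_le_div_iff₀ (by positivity) two_pos, mul_assoc]
  gcongr

lemma sin_torsionAngle_ne_zero (hk₀ : k ≠ 0) (hk : k ≤ N / 2) :
    Complex.sin (torsionAngle N k) ≠ 0 := by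
  have hN : N ≠ 0 := by omega
  have hpos : 0 < torsionAngle N k := by rw [torsionAngle]; positivity
  rw [← Complex.ofReal_sin, Complex.ofReal_ne_zero]
  exact (Real.sin_pos_of_pos_of_lt_pi hpos
    (by linarith [(torsionAngle_mem_Icc hk).2, Real.pi_pos])).ne'

lemma injOn_cos_torsionAngle_sq (hN : N ≠ 0) :
    Set.InjOn (fun k => Complex.cos (torsionAngle N k) ^ 2) (Set.Iic (N / 2)) := by
  intro k hk l hl hkl
  have hk' := torsionAngle_mem_Icc hk
  have hl' := torsionAngle_mem_Icc hl
  have hcos_sq : Real.cos (torsionAngle N k) ^ 2 = Real.cos (torsionAngle N l) ^ 2 := by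
    simpa only [← Complex.ofReal_cos, ← Complex.ofReal_pow, Complex.ofReal_inj] using hkl
  have hcos : Real.cos (torsionAngle N k) = Real.cos (torsionAngle N l) := by
    refine (sq_eq_sq₀ (Real.cos_nonneg_of_mem_Icc ⟨?_, hk'.2⟩)
      (Real.cos_nonneg_of_mem_Icc ⟨?_, hl'.2⟩)).1 hcos_sq
    · linarith [hk'.1, Real.pi_pos]
    · linarith [hl'.1, Real.pi_pos]
  have hangle : torsionAngle N k = torsionAngle N l :=
    Real.injOn_cos ⟨hk'.1, by linarith [hk'.2, Real.pi_pos]⟩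
      ⟨hl'.1, by linarith [hl'.2, Real.pi_pos]⟩ hcos
  have hN' : (N : ℝ) ≠ 0 := Nat.cast_ne_zero.2 hN
  rw [torsionAngle, torsionAngle, div_left_inj' hN', mul_right_inj' Real.pi_ne_zero] at hangle
  exact_mod_cast hangle

lemma exists_cos_torsionAngle_sq_eq (hN : N ≠ 0) {θ : ℂ} (hθ : Complex.sin (N * θ) = 0) :
    ∃ k ≤ N / 2, Complex.cos θ ^ 2 = Complex.cos (torsionAngle N k) ^ 2 := by
  obtain ⟨j, hj⟩ := Complex.sin_eq_zero_iff.1 hθ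
  have hN' : (N : ℂ) ≠ 0 := Nat.cast_ne_zero.2 hN
  have hN₀ : 0 < N := Nat.pos_of_ne_zero hN
  have hbound : (j.bmod N).natAbs ≤ N / 2 := by
    have := Int.le_bmod (x := j) hN₀
    have := Int.bmod_lt (x := j) hN₀
    omega
  refine ⟨_, hbound, ?_⟩
  have hdiv : (N : ℂ) * (j.bdiv N : ℂ) + (j.bmod N : ℂ) = j := by
    exact_mod_cast Int.bdiv_add_bmod j N
  have hθ_eq : θ = π * (j.bmod N : ℂ) / N + (j.bdiv N : ℂ) * π := by
    refine mul_left_cancel₀ hN' (hj.trans ?_)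
    rw [← hdiv]
    field_simp
    ring
  calc Complex.cos θ ^ 2 = Complex.cos (π * (j.bmod N : ℂ) / N) ^ 2 := by
        have hperiodic := Complex.cos_antiperiodic.mul Complex.cos_antiperiodic
        simpa only [hθ_eq, sq, Pi.mul_apply] using
          hperiodic.int_mul (j.bdiv N) (π * (j.bmod N : ℂ) / N)
    _ = Complex.cos (torsionAngle N (j.bmod N).natAbs) ^ 2 := by
        rw [torsionAngle]
        push_cast
        rcases Int.natAbs_eq (j.bmod N) with h | h <;> rw [h]
        · simp
        · simp [neg_div]

lemma coe_conjParam_mem_torsionClass (hN : N ≠ 0) (v : Fin 3 → ℂ) :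
    (conjParam (torsionAngle N k) v : PSL(2, ℂ)) ∈ torsionClass N k := by
  refine ⟨?_, by rw [sqTrace_coe, trace_conjParam]⟩
  rw [← QuotientGroup.mk_pow, conjParam_pow]
  refine coe_conjParam_eq_one (Complex.sin_eq_zero_iff.2 ⟨k, ?_⟩) v
  rw [torsionAngle]
  push_cast
  field_simp

lemma exists_coe_eq_of_sqTrace_eq {A : PSL(2, ℂ)} {t : ℂ} (h : sqTrace A = t ^ 2) :
    ∃ a : SL(2, ℂ), a = A ∧ a.1.trace = t := by
  obtain ⟨a, rfl⟩ := QuotientGroup.mk_surjective A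
  rw [sqTrace_coe] at h
  rcases sq_eq_sq_iff_eq_or_eq_neg.1 h with h | h
  · exact ⟨a, rfl, h⟩
  · exact ⟨-a, coe_neg a, by rw [Matrix.SpecialLinearGroup.coe_neg, Matrix.trace_neg, h, neg_neg]⟩

lemma eq_one_of_mem_torsionClass_zero (hN : N ≠ 0) {A : PSL(2, ℂ)} (hA : A ∈ torsionClass N 0) :
    A = 1 := by
  obtain ⟨a, rfl, htrace⟩ := exists_coe_eq_of_sqTrace_eq hA.2
  rw [coe_eq_one_of_pow_eq_one hN (by simpa [torsionAngle] using htrace) hA.1, QuotientGroup.mk_one]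

lemma torsionClass_eq_range (hN : N ≠ 0) (hk : k ≤ N / 2) :
    torsionClass N k = Set.range fun v => (conjParam (torsionAngle N k) v : PSL(2, ℂ)) := by
  refine Set.Subset.antisymm (fun A hA => ?_)
    (Set.range_subset_iff.2 (coe_conjParam_mem_torsionClass hN))
  rcases eq_or_ne k 0 with rfl | hk₀
  · exact ⟨0, (coe_conjParam_eq_one (by simp [torsionAngle]) 0).trans
      (eq_one_of_mem_torsionClass_zero hN hA).symm⟩
  · obtain ⟨a, rfl, htrace⟩ := exists_coe_eq_of_sqTrace_eq hA.2
    obtain ⟨v, rfl⟩ := exists_conjParam_eq (sin_torsionAngle_ne_zero hk₀ hk) htrace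
    exact ⟨v, rfl⟩

lemma exists_mem_torsionClass_sqDiag_eq_sqOffDiag_eq (hk₀ : k ≠ 0) (hk : k ≤ N / 2) (α β : ℂ) :
    ∃ A ∈ torsionClass N k, sqDiag A = α ∧ sqOffDiag A = β := by
  obtain ⟨a, htrace, hdiag, hoffDiag⟩ := exists_trace_eq_and_sqDiag_eq_and_sqOffDiag_eq
    (2 * Complex.cos (torsionAngle N k)) α β
  obtain ⟨v, rfl⟩ := exists_conjParam_eq (sin_torsionAngle_ne_zero hk₀ hk) htrace
  exact ⟨_, coe_conjParam_mem_torsionClass (by omega) v, hdiag, hoffDiag⟩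

lemma eq_of_mem_torsionClass (hN : N ≠ 0) (hk : k ≤ N / 2) (hl : l ≤ N / 2) {A : PSL(2, ℂ)}
    (hAk : A ∈ torsionClass N k) (hAl : A ∈ torsionClass N l) : k = l := by
  refine injOn_cos_torsionAngle_sq hN hk hl ?_
  have hsq := hAk.2.symm.trans hAl.2
  rw [mul_pow, mul_pow] at hsq
  exact mul_left_cancel₀ (by norm_num) hsq

lemma exists_mem_torsionClass (hN : N ≠ 0) {A : PSL(2, ℂ)} (hA : A ^ N = 1) :
    ∃ k ≤ N / 2, A ∈ torsionClass N k := by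
  obtain ⟨a, rfl⟩ := QuotientGroup.mk_surjective A
  obtain ⟨θ, hθ⟩ := Complex.cos_surjective (a.1.trace / 2)
  have htrace : a.1.trace = 2 * Complex.cos θ := by rw [hθ]; ring
  obtain ⟨k, hk, hcos⟩ : ∃ k ≤ N / 2, Complex.cos θ ^ 2 = Complex.cos (torsionAngle N k) ^ 2 := by
    by_cases hsin : Complex.sin θ = 0
    · exact ⟨0, zero_le, by simp [Complex.cos_sq', hsin, torsionAngle]⟩
    · refine exists_cos_torsionAngle_sq_eq hN (Complex.sin_eq_zero_iff_cos_eq.2 ?_)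
      obtain ⟨v, rfl⟩ := exists_conjParam_eq hsin htrace
      have htraceN := trace_conjParam (N * θ) v
      rw [← QuotientGroup.mk_pow, ← QuotientGroup.mk_one, coe_eq_coe_iff, conjParam_pow] at hA
      refine hA.imp (fun h => ?_) fun h => ?_ <;> rw [h] at htraceN
      · simpa [eq_comm] using htraceN
      · norm_num at htraceN
        linear_combination - htraceN / 2
  exact ⟨k, hk, hA, by rw [sqTrace_coe, htrace, mul_pow, mul_pow, hcos]⟩

end Torsion

section Components

/-- `G` is the free product of cyclic groups of orders `N i`, generated by the elements `b i`. The
universal property is only required for target groups in `Type`, such as `PSL(2, ℂ)`. -/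
structure IsFreeProductOfCyclics {G ι : Type*} [Group G] (b : ι → G) (N : ι → ℕ) : Prop where
  closure_range : Subgroup.closure (Set.range b) = ⊤
  pow_eq_one (i : ι) : b i ^ N i = 1
  exists_hom {H : Type} [Group H] (a : ι → H) (ha : ∀ i, a i ^ N i = 1) :
    ∃ φ : G →* H, ∀ i, φ (b i) = a i

variable {G ι : Type*} [Group G] {b : ι → G} {N k : ι → ℕ}

/-- The representations which send each generator `b i` to the conjugacy class
`torsionClass (N i) (k i)`; for a free product of cyclic groups these turn out to be the irreducible
components of the representation variety. -/
def component (b : ι → G) (N k : ι → ℕ) : Set (G →* PSL(2, ℂ)) :=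
  {ρ | ∀ i, ρ (b i) ∈ torsionClass (N i) (k i)}

lemma disjoint_component {l : ι → ℕ} (hN : ∀ i, N i ≠ 0) (hk : ∀ i, k i ≤ N i / 2)
    (hl : ∀ i, l i ≤ N i / 2) (hkl : k ≠ l) : Disjoint (component b N k) (component b N l) :=
  Set.disjoint_left.2 fun _ hρk hρl =>
    hkl (funext fun i => eq_of_mem_torsionClass (hN i) (hk i) (hl i) (hρk i) (hρl i))

lemma dim_restrict_regularRep {Z : Set (G →* PSL(2, ℂ))} {S : Finset ι}
    (hS : ∀ ρ ∈ Z, ∀ i ∉ S, ρ (b i) = 1)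
    (htrace : ∀ i, ((fun ρ => sqTrace (ρ (b i))) '' Z).Finite)
    (hcoord : ∀ α β : ι → ℂ, ∃ ρ ∈ Z, ∀ i ∈ S, sqDiag (ρ (b i)) = α i ∧ sqOffDiag (ρ (b i)) = β i) :
    dim (restrict (regularRep b) Z) = ((2 * S.card : ℕ) : WithBot ℕ∞) := by
  classical
  let u : S × Bool → Z → ℂ := fun e ρ =>
    bif e.2 then sqDiag (ρ.1 (b e.1)) else sqOffDiag (ρ.1 (b e.1))
  have hu : ∀ z : S × Bool → ℂ, ∃ ρ, ∀ e, u e ρ = z e := by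
    intro z
    obtain ⟨ρ, hρ, hρz⟩ := hcoord (fun i => if hi : i ∈ S then z (⟨i, hi⟩, true) else 0)
      (fun i => if hi : i ∈ S then z (⟨i, hi⟩, false) else 0)
    refine ⟨⟨ρ, hρ⟩, ?_⟩
    rintro ⟨⟨i, hi⟩, _ | _⟩ <;> simp [u, hρz i hi, hi]
  have huO : ∀ e, u e ∈ restrict (regularRep b) Z := by
    rintro ⟨i, _ | _⟩
    exacts [⟨_, sqOffDiag_mem_regularRep b i, rfl⟩, ⟨_, sqDiag_mem_regularRep b i, rfl⟩]
  have hu_mem (e) : u e ∈ Algebra.adjoin ℂ (Set.range u) := Algebra.subset_adjoin ⟨e, rfl⟩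
  let g : Z → ι → SL(2, ℂ) := fun ρ i => if i ∈ S then Quotient.out (ρ.1 (b i)) else 1
  have hg (ρ : Z) (i : ι) : ρ.1 (b i) = (g ρ i : PSL(2, ℂ)) := by
    by_cases hi : i ∈ S
    · simp [g, hi]
    · simpa [g, hi] using hS ρ.1 ρ.2 i hi
  rw [dim_eq_natCard_of_isIntegral huO hu]
  · simp [mul_comm]
  rintro _ ⟨f, hf, rfl⟩
  change f ∘ Subtype.val ∈ (integralClosure _ _).restrictScalars ℂ
  refine comp_mem_of_mem_regularRep (g := g) (fun i => ?_) hg hf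
  by_cases hi : i ∈ S
  · apply mem_entrySubgroup_integralClosure <;> simp only [← hg]
    · refine isIntegral_of_finite_range _ ((htrace i).subset ?_)
      exact Set.range_subset_iff.2 fun ρ => ⟨ρ.1, ρ.2, rfl⟩
    · exact isIntegral_of_mem (hu_mem (⟨i, hi⟩, true))
    · exact isIntegral_of_mem (hu_mem (⟨i, hi⟩, false))
  · simp only [g, hi, if_false]
    exact const_mem_entrySubgroup 1

lemma noZeroDivisors_adjoin_range_apply (τ : Type*) :
    NoZeroDivisors (Algebra.adjoin ℂ (Set.range fun (j : τ) (z : τ → ℂ) => z j)) := by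
  have hindep : AlgebraicIndependent ℂ fun (j : τ) (z : τ → ℂ) => z j :=
    algebraicIndependent_of_forall_exists_apply_eq fun z => ⟨z, fun _ => rfl⟩
  exact hindep.aevalEquiv.symm.toMulEquiv.noZeroDivisors _

namespace IsFreeProductOfCyclics

variable (hb : IsFreeProductOfCyclics b N)

include hb

lemma apply_pow_eq_one (ρ : G →* PSL(2, ℂ)) (i : ι) : ρ (b i) ^ N i = 1 := by
  rw [← map_pow, hb.pow_eq_one, map_one]

lemma hom_ext {ρ ρ' : G →* PSL(2, ℂ)} (h : ∀ i, ρ (b i) = ρ' (b i)) : ρ = ρ' :=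
  MonoidHom.eq_of_eqOn_dense hb.closure_range (Set.eqOn_range.2 (funext h))

variable (k) in
lemma isClosed_component : IsClosed[zariskiTopology (regularRep b)] (component b N k) := by
  refine isClosed_zariskiTopology_iff.2 ⟨Set.range fun i ρ =>
    sqTrace (ρ (b i)) - (2 * Complex.cos (torsionAngle (N i) (k i))) ^ 2, ?_, ?_⟩
  · rintro _ ⟨i, rfl⟩
    exact Subalgebra.sub_mem _ (sqTrace_mem_regularRep b i) (Subalgebra.algebraMap_mem _ _)
  · ext ρ
    simp [component, torsionClass, zeroSet, sub_eq_zero, hb.apply_pow_eq_one]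

variable (hN : ∀ i, N i ≠ 0)

include hN

lemma exists_mem_component (ρ : G →* PSL(2, ℂ)) :
    ∃ k : ι → ℕ, (∀ i, k i ≤ N i / 2) ∧ ρ ∈ component b N k := by
  choose k hk hρ using fun i => exists_mem_torsionClass (hN i) (hb.apply_pow_eq_one ρ i)
  exact ⟨k, hk, hρ⟩

variable (hk : ∀ i, k i ≤ N i / 2)

include hk

lemma isIrreducible_component :
    @IsIrreducible _ (zariskiTopology (regularRep b)) (component b N k) := by
  let g (v : ι × Fin 3 → ℂ) (i : ι) : SL(2, ℂ) :=
    conjParam (torsionAngle (N i) (k i)) fun j => v (i, j)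
  choose F hF using fun v => hb.exists_hom (fun i => (g v i : PSL(2, ℂ)))
    fun i => (coe_conjParam_mem_torsionClass (hN i) _).1
  have hrange : Set.range F = component b N k := by
    ext ρ
    constructor
    · rintro ⟨v, rfl⟩ i
      rw [hF]
      exact coe_conjParam_mem_torsionClass (hN i) _
    · intro hρ
      simp only [component, torsionClass_eq_range (hN _) (hk _)] at hρ
      choose v hv using hρ
      exact ⟨fun e => v e.1 e.2, hb.hom_ext fun i => (hF _ i).trans (hv i)⟩
  let P := Algebra.adjoin ℂ (Set.range fun (e : ι × Fin 3) (v : ι × Fin 3 → ℂ) => v e)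
  have : NoZeroDivisors P := noZeroDivisors_adjoin_range_apply _
  have hP (e : ι × Fin 3) : (fun v => v e) ∈ P := Algebra.subset_adjoin ⟨e, rfl⟩
  rw [← hrange]
  refine isIrreducible_range_of_noZeroDivisors (P := P) fun f hf =>
    comp_mem_of_mem_regularRep (g := g) (fun i => ?_) hF hf
  exact conjParam_mem_entrySubgroup (fun j => hP (i, j)) _

lemma exists_mem_component_sqDiag_eq_sqOffDiag_eq (α β : ι → ℂ) : ∃ ρ ∈ component b N k,
    ∀ i, k i ≠ 0 → sqDiag (ρ (b i)) = α i ∧ sqOffDiag (ρ (b i)) = β i := by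
  have hA (i : ι) : ∃ A ∈ torsionClass (N i) (k i),
      k i ≠ 0 → sqDiag A = α i ∧ sqOffDiag A = β i := by
    by_cases hki : k i = 0
    · exact ⟨_, coe_conjParam_mem_torsionClass (hN i) 0, fun h => absurd hki h⟩
    · obtain ⟨A, hA, hcoord⟩ :=
        exists_mem_torsionClass_sqDiag_eq_sqOffDiag_eq hki (hk i) (α i) (β i)
      exact ⟨A, hA, fun _ => hcoord⟩
  choose A hA hcoord using hA
  obtain ⟨ρ, hρ⟩ := hb.exists_hom A fun i => (hA i).1
  exact ⟨ρ, fun i => hρ i ▸ hA i, fun i hi => hρ i ▸ hcoord i hi⟩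

lemma dim_component [Fintype ι] : dim (restrict (regularRep b) (component b N k)) =
    ((2 * Finset.card {i | k i ≠ 0} : ℕ) : WithBot ℕ∞) := by
  refine dim_restrict_regularRep (fun ρ hρ i hi => ?_) (fun i => ?_) fun α β => ?_
  · have hki : k i = 0 := by simpa using hi
    exact eq_one_of_mem_torsionClass_zero (hN i) (hki ▸ hρ i)
  · refine (Set.finite_singleton ((2 * Complex.cos (torsionAngle (N i) (k i))) ^ 2)).subset ?_
    rintro _ ⟨ρ, hρ, rfl⟩
    exact (hρ i).2
  · simpa using hb.exists_mem_component_sqDiag_eq_sqOffDiag_eq hN hk α β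

omit hk

lemma dim_regularRep [Fintype ι] :
    dim (regularRep b) = ((2 * Finset.card {i | 2 ≤ N i} : ℕ) : WithBot ℕ∞) := by
  rw [← dim_restrict_univ]
  refine dim_restrict_regularRep (fun ρ _ i hi => ?_) (fun i => ?_) fun α β => ?_
  · have hi2 : ¬2 ≤ N i := by simpa using hi
    have hNi : N i = 1 := by have := hN i; omega
    simpa [hNi] using hb.apply_pow_eq_one ρ i
  · refine ((Set.finite_Iic (N i / 2)).image
      fun k => (2 * Complex.cos (torsionAngle (N i) k)) ^ 2).subset ?_
    rintro _ ⟨ρ, -, rfl⟩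
    obtain ⟨k, hk, hρ⟩ := exists_mem_torsionClass (hN i) (hb.apply_pow_eq_one ρ i)
    exact ⟨k, hk, hρ.2.symm⟩
  · obtain ⟨ρ, -, hρ⟩ := hb.exists_mem_component_sqDiag_eq_sqOffDiag_eq
      (k := fun i => min 1 (N i / 2)) hN (fun i => min_le_right _ _) α β
    refine ⟨ρ, trivial, fun i hi => hρ i ?_⟩
    have hi2 : 2 ≤ N i := by simpa using hi
    omega

lemma numComponents_regularRep_eq_encard [Fintype ι] (d : ℕ) : numComponents (regularRep b) d =
    {k : ∀ i, Fin (N i / 2 + 1) | 2 * Finset.card {i | k i ≠ 0} = d}.encard := by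
  refine numComponents_eq_encard (Z := fun k => component b N fun i => k i)
    (fun k => hb.isClosed_component _)
    (fun k => hb.isIrreducible_component hN fun i => Nat.le_of_lt_succ (k i).2) ?_ ?_ ?_ d
  · refine Set.eq_univ_of_forall fun ρ => Set.mem_iUnion.2 ?_
    obtain ⟨k, hk, hρ⟩ := hb.exists_mem_component hN ρ
    exact ⟨fun i => ⟨k i, Nat.lt_succ_of_le (hk i)⟩, hρ⟩
  · exact fun k l hkl => disjoint_component hN (fun i => Nat.le_of_lt_succ (k i).2)
      (fun i => Nat.le_of_lt_succ (l i).2)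
      fun h => hkl (funext fun i => Fin.ext (congrFun h i))
  · intro k
    rw [hb.dim_component hN fun i => Nat.le_of_lt_succ (k i).2]
    simp only [← Fin.val_ne_zero_iff]

end IsFreeProductOfCyclics

end Components

section Counting

variable {ι : Type*} [Fintype ι]

lemma card_filter_support_eq [DecidableEq ι] (n : ι → ℕ) (s : Finset ι) :
    Finset.card {k : ∀ i, Fin (n i + 1) | ({i | k i ≠ 0} : Finset ι) = s} = ∏ i ∈ s, n i := by
  have hpi : ({k | ({i | k i ≠ 0} : Finset ι) = s} : Finset (∀ i, Fin (n i + 1))) =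
      Fintype.piFinset fun i => if i ∈ s then {0}ᶜ else {0} := by
    ext k
    simp only [Finset.mem_filter_univ, Finset.ext_iff, Fintype.mem_piFinset]
    refine forall_congr' fun i => ?_
    by_cases hi : i ∈ s <;> simp [hi]
  rw [hpi, Fintype.card_piFinset, ← Finset.prod_subset s.subset_univ]
  · exact Finset.prod_congr rfl fun i hi => by simp [hi, Finset.card_compl]
  · intro i _ hi
    simp [hi]

lemma encard_setOf_two_mul_card_support_eq (n : ι → ℕ) (d : ℕ) :
    {k : ∀ i, Fin (n i + 1) | 2 * Finset.card {i | k i ≠ 0} = d}.encard =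
      (∑ s : Finset ι with 2 * s.card = d, ∏ i ∈ s, n i : ℕ) := by
  classical
  rw [← Finset.coe_filter_univ, Set.encard_coe_eq_coe_finsetCard,
    Finset.card_eq_sum_card_fiberwise (f := fun k => ({i | k i ≠ 0} : Finset ι))
      (t := {s | 2 * s.card = d}) fun k hk => by simpa using hk]
  congr 1
  refine Finset.sum_congr rfl fun s hs => ?_
  rw [← card_filter_support_eq, Finset.filter_filter]
  congr 1
  ext k
  simp only [Finset.mem_filter_univ] at hs ⊢
  exact and_iff_right_of_imp fun hk => hk ▸ hs

lemma profile_four_eq {X : Type*} {O : Subalgebra ℂ (X → ℂ)} {n : Fin 2 → ℕ}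
    (hO : ∀ d, numComponents O d =
      (∑ s : Finset (Fin 2) with 2 * s.card = d, ∏ i ∈ s, n i : ℕ)) :
    profile O 4 = ![((n 0 * n 1 : ℕ) : ℕ∞), 0, ((n 0 + n 1 : ℕ) : ℕ∞), 0, 1] := by
  have hsubsets : (Finset.univ : Finset (Finset (Fin 2))) = {∅, {0}, {1}, {0, 1}} := by decide
  have hnum (d : ℕ) : numComponents O d = ((if d = 0 then 1 else 0) + (if d = 2 then n 0 else 0) +
      (if d = 2 then n 1 else 0) + (if d = 4 then n 0 * n 1 else 0) : ℕ) := by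
    rw [hO, Finset.sum_filter, hsubsets, Finset.sum_insert (by decide),
      Finset.sum_insert (by decide), Finset.sum_insert (by decide)]
    simp [eq_comm, add_assoc]
  funext j
  fin_cases j <;> simp [profile, hnum]

lemma profile_four_eq_of_div_two_eq {X : Type*} {O : Subalgebra ℂ (X → ℂ)} {m n : ℕ}
    (hO : ∀ d, numComponents O d =
      (∑ s : Finset (Fin 2) with 2 * s.card = d, ∏ i ∈ s, ![m, n] i / 2 : ℕ))
    {a b p s : ℕ} (ha : m / 2 = a) (hb : n / 2 = b) (hp : p = 4 * (a * b))
    (hs : s = 2 * (a + b)) :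
    profile O 4 = ![((p / 4 : ℕ) : ℕ∞), 0, ((s / 2 : ℕ) : ℕ∞), 0, 1] := by
  subst ha hb hp hs
  simpa using profile_four_eq hO

end Counting

section CoprodCyclic

lemma zpowers_ofAdd_one (m : ℕ) :
    Subgroup.zpowers (Multiplicative.ofAdd (1 : ZMod m)) = ⊤ := by
  refine (Subgroup.eq_top_iff' _).2 fun a => ?_
  obtain ⟨k, hk⟩ := ZMod.intCast_surjective a.toAdd
  refine ⟨k, ?_⟩
  change Multiplicative.ofAdd (1 : ZMod m) ^ k = a
  rw [← ofAdd_zsmul, zsmul_one, hk, ofAdd_toAdd]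

lemma ofAdd_one_pow_self (m : ℕ) : Multiplicative.ofAdd (1 : ZMod m) ^ m = 1 := by
  rw [← ofAdd_nsmul, nsmul_one, ZMod.natCast_self, ofAdd_zero]

lemma exists_hom_ofAdd_one_eq {H : Type*} [Group H] {m : ℕ} {A : H} (hA : A ^ m = 1) :
    ∃ f : Multiplicative (ZMod m) →* H, f (.ofAdd 1) = A := by
  have hgen := (Subgroup.eq_top_iff' _).1 (zpowers_ofAdd_one m)
  refine ⟨monoidHomOfForallMemZpowers hgen (g' := A) ?_,
    monoidHomOfForallMemZpowers_apply_gen _ _⟩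
  rw [orderOf_ofAdd_eq_addOrderOf, ZMod.addOrderOf_one]
  exact orderOf_dvd_of_pow_eq_one hA

lemma isFreeProductOfCyclics_coprod (m n : ℕ) : IsFreeProductOfCyclics
    (![.inl (.ofAdd 1), .inr (.ofAdd 1)] :
      Fin 2 → Monoid.Coprod (Multiplicative (ZMod m)) (Multiplicative (ZMod n))) ![m, n] where
  closure_range := by
    rw [← top_le_iff, ← Monoid.Coprod.range_inl_sup_range_inr, MonoidHom.range_eq_map,
      MonoidHom.range_eq_map, ← zpowers_ofAdd_one, ← zpowers_ofAdd_one, MonoidHom.map_zpowers,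
      MonoidHom.map_zpowers, sup_le_iff, Subgroup.zpowers_le, Subgroup.zpowers_le]
    exact ⟨Subgroup.subset_closure ⟨0, rfl⟩, Subgroup.subset_closure ⟨1, rfl⟩⟩
  pow_eq_one i := by
    fin_cases i <;> simp [← map_pow, ofAdd_one_pow_self]
  exists_hom a ha := by
    obtain ⟨f, hf⟩ := exists_hom_ofAdd_one_eq (m := m) (ha 0)
    obtain ⟨g, hg⟩ := exists_hom_ofAdd_one_eq (m := n) (ha 1)
    refine ⟨Monoid.Coprod.lift f g, Fin.forall_fin_two.2 ⟨?_, ?_⟩⟩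
    · exact (Monoid.Coprod.lift_apply_inl f g _).trans hf
    · exact (Monoid.Coprod.lift_apply_inr f g _).trans hg

end CoprodCyclic

end RepProfile

end

theorem theorem4p5_general {G ι κ : Type*} [Group G] [Fintype ι] {b : ι → G} {N : ι → ℕ}
    (hb : RepProfile.IsFreeProductOfCyclics b N) (hN : ∀ i, N i ≠ 0) {x : κ → G}
    (hx : Subgroup.closure (Set.range x) = ⊤) :
    RepProfile.dim (RepProfile.regularRep x) = (2 * Finset.card {i | 2 ≤ N i} : ℕ) ∧
      ∀ d, RepProfile.numComponents (RepProfile.regularRep x) d =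
        (∑ s : Finset ι with 2 * s.card = d, ∏ i ∈ s, N i / 2 : ℕ) := by
  rw [RepProfile.regularRep_eq_of_closure_eq_top hx hb.closure_range]
  refine ⟨hb.dim_regularRep hN, fun d => ?_⟩
  rw [hb.numComponents_regularRep_eq_encard hN,
    RepProfile.encard_setOf_two_mul_card_support_eq fun i => N i / 2]

theorem theorem4p5 (m n : ℕ) (hm : 2 ≤ m) (hn : 2 ≤ n) (k : ℕ)
    (x : Fin k → Monoid.Coprod (Multiplicative (ZMod m)) (Multiplicative (ZMod n)))
    (hx : Subgroup.closure (Set.range x) = ⊤) :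
    RepProfile.dim (RepProfile.regularRep x) = 4 ∧
    (Even m → Even n → RepProfile.profile (RepProfile.regularRep x) 4 =
      ![((m * n / 4 : ℕ) : ℕ∞), 0, (((m + n) / 2 : ℕ) : ℕ∞), 0, 1]) ∧
    (Odd m → Even n → RepProfile.profile (RepProfile.regularRep x) 4 =
      ![((n * (m - 1) / 4 : ℕ) : ℕ∞), 0, (((m + n - 1) / 2 : ℕ) : ℕ∞), 0, 1]) ∧
    (Even m → Odd n → RepProfile.profile (RepProfile.regularRep x) 4 =
      ![((m * (n - 1) / 4 : ℕ) : ℕ∞), 0, (((m + n - 1) / 2 : ℕ) : ℕ∞), 0, 1]) ∧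
    (Odd m → Odd n → RepProfile.profile (RepProfile.regularRep x) 4 =
      ![(((m - 1) * (n - 1) / 4 : ℕ) : ℕ∞), 0, (((m + n - 2) / 2 : ℕ) : ℕ∞), 0, 1]) := by
  obtain ⟨hdim, hnum⟩ := theorem4p5_general (RepProfile.isFreeProductOfCyclics_coprod m n)
    (Fin.forall_fin_two.2 ⟨(by omega : m ≠ 0), (by omega : n ≠ 0)⟩) hx
  refine ⟨by simp [hdim, Finset.filter_true_of_mem, Fin.forall_fin_two, hm, hn], ?_, ?_, ?_, ?_⟩
  all_goals
    rintro ⟨a, rfl⟩ ⟨b, rfl⟩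
    exact RepProfile.profile_four_eq_of_div_two_eq hnum (a := a) (b := b)
      (by omega) (by omega) (by grind) (by omega)
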